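/- Let $X$ be a Tychonoff (completely regular Hausdorff) space, and let $V(X)$ be the free topological vector space over $X$, i.e. the real topological vector space, with a continuous map $i\colon X\to V(X)$, such that for every continuous map $f$ from $X$ to a real topological vector space $E$ there is a unique continuous linear operator $\bar f\colon V(X)\to E$ with $f=\bar f\circ i$. (Concretely, $V(X)$ is the space of finite formal real linear combinations of points of $X$ with the finest vector topology making the canonical map $X\to V(X)$ continuous.) A topological space is called submetrizable if it admits a coarser metrizable topology. A topological space $Y$ is called a $k$-space if a subset $C\subseteq Y$ is closed whenever $C\cap K$ is closed in $K$ for every compact $K\subseteq Y$, and sequential if every subset that contains the limits of all its convergent sequences is closed. If $X$ is submetrizable, then $V(X)$ is submetrizable; moreover, $V(X)$ is then a $k$-space if and only if it is sequential. -/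

import Mathlib

open Topology

/-- A topological space is submetrizable if it admits a coarser metrizable topology
(equivalently, a continuous injection into a metric space). -/
def Submetrizable (X : Type*) [t : TopologicalSpace X] : Prop :=
  ∃ s : TopologicalSpace X, t ≤ s ∧ @TopologicalSpace.MetrizableSpace X s

/-- The vector space underlying the free topological vector space `V(X)`: finite formal real
linear combinations of points of `X`. -/
def FreeTVS (X : Type*) : Type _ := X →₀ ℝ

namespace FreeTVS

noncomputable section

variable {X : Type*}

instance : AddCommGroup (FreeTVS X) := inferInstanceAs (AddCommGroup (X →₀ ℝ))

instance : Module ℝ (FreeTVS X) := inferInstanceAs (Module ℝ (X →₀ ℝ))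

/-- The canonical map `i : X → V(X)`. -/
def of (x : X) : FreeTVS X := (Finsupp.single x 1 : X →₀ ℝ)

/-- The vector topologies on the linear combinations of points of `X` for which the canonical map
`X → V(X)` is continuous. -/
def IsAdmissible [TopologicalSpace X] (s : TopologicalSpace (FreeTVS X)) : Prop :=
  @IsTopologicalAddGroup (FreeTVS X) s _ ∧ @ContinuousSMul ℝ (FreeTVS X) _ _ s ∧
    @Continuous X (FreeTVS X) _ s of

/-- The topology of `V(X)` is the finest vector topology for which `X → V(X)` is continuous. -/
instance [TopologicalSpace X] : TopologicalSpace (FreeTVS X) :=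
  sInf {s | IsAdmissible s}

variable [TopologicalSpace X]

instance : IsTopologicalAddGroup (FreeTVS X) :=
  topologicalAddGroup_sInf fun _ hs => hs.1

instance : ContinuousSMul ℝ (FreeTVS X) :=
  continuousSMul_sInf fun _ hs => hs.2.1

theorem continuous_of : Continuous (of : X → FreeTVS X) :=
  continuous_sInf_rng.2 fun _ hs => hs.2.2

/-- The universal property of the free topological vector space: each continuous map from `X` to a
topological vector space `E` extends to a unique continuous linear operator `V(X) → E`. -/
theorem existsUnique_lift {E : Type*} [AddCommGroup E] [Module ℝ E] [TopologicalSpace E]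
    [IsTopologicalAddGroup E] [ContinuousSMul ℝ E] (f : X → E) (hf : Continuous f) :
    ∃! g : FreeTVS X →L[ℝ] E, ∀ x, g (of x) = f x := by
  let L : FreeTVS X →ₗ[ℝ] E := Finsupp.linearCombination ℝ f
  have hL : ∀ x, L (of x) = f x := fun x =>
    (Finsupp.linearCombination_single ℝ (1 : ℝ) x).trans (one_smul ℝ (f x))
  have hadm : IsAdmissible (TopologicalSpace.induced L ‹TopologicalSpace E›) := by
    refine ⟨topologicalAddGroup_induced L, continuousSMul_induced L, ?_⟩
    rw [continuous_induced_rng]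
    exact hf.congr fun x => (hL x).symm
  have hc : Continuous L := continuous_iff_le_induced.2 (sInf_le hadm)
  refine ⟨⟨L, hc⟩, hL, fun g hg => ?_⟩
  have h : g.toLinearMap = L := by
    refine Finsupp.lhom_ext' (M := ℝ) (N := E) fun x => LinearMap.ext_ring ?_
    exact (hg x).trans (hL x).symm
  exact ContinuousLinearMap.coe_injective h

/-- For Tychonoff `X` the space `V(X)` is Hausdorff. -/
instance [T35Space X] : T2Space (FreeTVS X) := by
  classical
  choose g hg using fun f : C(X, ℝ) => (existsUnique_lift f f.continuous).exists
  have key : ∀ (f : C(X, ℝ)) (v : FreeTVS X),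
      g f v = Finsupp.linearCombination ℝ f (show X →₀ ℝ from v) := by
    intro f v
    have h : (g f).toLinearMap = (Finsupp.linearCombination ℝ f : (X →₀ ℝ) →ₗ[ℝ] ℝ) := by
      refine Finsupp.lhom_ext' (M := ℝ) (N := ℝ) fun x => LinearMap.ext_ring ?_
      refine (hg f x).trans ?_
      simp
    exact LinearMap.congr_fun h v
  refine T2Space.of_injective_continuous (f := fun v (f : C(X, ℝ)) => g f v) ?_
    (continuous_pi fun f => (g f).continuous)
  intro v w hvw
  rw [← sub_eq_zero]
  set u : X →₀ ℝ := v - w with hu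
  have hz : ∀ f : C(X, ℝ), Finsupp.linearCombination ℝ f u = 0 := by
    intro f
    refine (key f (v - w)).symm.trans ?_
    rw [map_sub, sub_eq_zero]
    exact congrFun hvw f
  refine Finsupp.ext (f := u) (g := 0) fun x => ?_
  obtain ⟨f, hf, hfx, hfK⟩ := CompletelyRegularSpace.completely_regular x
    ((u.support.erase x : Finset X) : Set X) (Finset.finite_toSet _).isClosed (by simp)
  have h := hz ⟨fun y => 1 - (f y : ℝ), by fun_prop⟩
  rw [Finsupp.linearCombination_apply, Finsupp.sum, Finset.sum_eq_single x] at h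
  · simpa [hfx] using h
  · intro y hy hyx
    have : f y = 1 := hfK (by simpa [hyx] using hy)
    simp [this]
  · intro hx
    simp [Finsupp.notMem_support_iff.1 hx]

end

end FreeTVS

/-! A coarser metric on `X` gives a continuous injection into a metric space `M`, and `cone` maps
`M` continuously onto a linearly independent family in a Banach space. The induced operator on
`V(X)` is then continuous and injective, so the norm pulls back to a coarser metric. Compact subsets
of a submetrizable space are metrizable, so there k-spaces are sequential; conversely, a convergent
sequence with its limit is compact. -/

namespace FreeTVS

open scoped BoundedContinuousFunction

/-- The truncated cones of radius `1 / (n + 1)` around `x`, as a bounded function of the evaluation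
point and of `n`. -/
noncomputable def cone {M : Type*} [PseudoMetricSpace M] (x : M) : (M × ℕ) →ᵇ ℝ :=
  BoundedContinuousFunction.ofNormedAddCommGroup
    (fun p => max 0 (1 / ((p.2 : ℝ) + 1) - dist x p.1))
    (by
      have h : Continuous fun n : ℕ => 1 / ((n : ℝ) + 1) := continuous_of_discreteTopology
      have h' : Continuous fun p : M × ℕ => 1 / ((p.2 : ℝ) + 1) := h.comp continuous_snd
      fun_prop) 1 fun p => by
      rw [Real.norm_of_nonneg (le_max_left _ _)]
      have h : 1 / ((p.2 : ℝ) + 1) ≤ 1 := by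
        rw [div_le_one (by positivity)]
        exact le_add_of_nonneg_left (Nat.cast_nonneg _)
      exact max_le zero_le_one (by linarith [dist_nonneg (x := x) (y := p.1)])

theorem cone_apply {M : Type*} [PseudoMetricSpace M] (x y : M) (n : ℕ) :
    cone x (y, n) = max 0 (1 / ((n : ℝ) + 1) - dist x y) := rfl

theorem continuous_cone {M : Type*} [PseudoMetricSpace M] : Continuous (cone : M → _) := by
  refine (LipschitzWith.of_dist_le_mul (K := 1) fun x y => ?_).continuous
  rw [NNReal.coe_one, one_mul, BoundedContinuousFunction.dist_le dist_nonneg]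
  rintro ⟨z, n⟩
  rw [cone_apply, cone_apply, Real.dist_eq]
  refine (abs_max_sub_max_le_max _ _ _ _).trans ?_
  rw [sub_self, abs_zero, sub_sub_sub_cancel_left, abs_sub_comm]
  exact max_le dist_nonneg (abs_dist_sub_le x y z)

/-- At `(x, n)` with `1 / (n + 1)` below the distances from `x` to the other centres, only the cone
at `x` survives. The coordinate `n` puts all radii into one function. -/
theorem linearIndependent_cone {M : Type*} [MetricSpace M] :
    LinearIndependent ℝ (cone : M → _) := by
  classical
  rw [linearIndependent_iff']
  intro s a h x hx
  obtain ⟨n, hn⟩ : ∃ n : ℕ, ∀ y ∈ s, y ≠ x → 1 / ((n : ℝ) + 1) ≤ dist y x := by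
    have h : ∀ᶠ n : ℕ in Filter.atTop, ∀ y ∈ s, y ≠ x → 1 / ((n : ℝ) + 1) ≤ dist y x := by
      rw [Filter.eventually_all_finset]
      intro y _
      by_cases hyx : y = x
      · simp [hyx]
      · filter_upwards [tendsto_one_div_add_atTop_nhds_zero_nat.eventually
          (gt_mem_nhds (dist_pos.2 hyx))] with n hn _ using hn.le
    exact h.exists
  have h0 := congrArg (BoundedContinuousFunction.evalCLM ℝ (x, n)) h
  rw [map_sum, map_zero, Finset.sum_eq_single_of_mem x hx] at h0
  · have hpos : (0 : ℝ) < 1 / ((n : ℝ) + 1) := by positivity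
    simpa [cone_apply, hpos.ne', max_eq_right hpos.le, Nat.cast_add_one_ne_zero,
      max_eq_right (inv_nonneg.2 (Nat.cast_add_one_pos (α := ℝ) n).le)] using h0
  · intro y hy hyx
    have : cone y (x, n) = 0 := by
      rw [cone_apply, max_eq_left (sub_nonpos.2 (hn y hy hyx))]
    simp [this]

end FreeTVS

universe u

theorem Submetrizable.of_injective_continuous {X Y : Type*} [TopologicalSpace X]
    [TopologicalSpace Y] [TopologicalSpace.MetrizableSpace Y] {f : X → Y}
    (hf : Function.Injective f) (hc : Continuous f) : Submetrizable X := by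
  let t : TopologicalSpace X := TopologicalSpace.induced f ‹_›
  exact ⟨t, continuous_iff_le_induced.1 hc,
    IsEmbedding.metrizableSpace (f := f) ⟨⟨rfl⟩, hf⟩⟩

theorem Submetrizable.exists_injective_continuous {X : Type u} [t : TopologicalSpace X]
    (h : Submetrizable X) :
    ∃ (Y : Type u) (_ : MetricSpace Y) (f : X → Y), Function.Injective f ∧ Continuous f := by
  obtain ⟨s, hs, hm⟩ := h
  exact ⟨X, @TopologicalSpace.metrizableSpaceMetric X s hm, id, Function.injective_id,
    continuous_id_iff_le.2 hs⟩

theorem FreeTVS.submetrizable {X : Type*} [TopologicalSpace X] (hX : Submetrizable X) :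
    Submetrizable (FreeTVS X) := by
  obtain ⟨Y, _, f, hf, hfc⟩ := hX.exists_injective_continuous
  obtain ⟨g, hg, -⟩ := existsUnique_lift (cone ∘ f) (continuous_cone.comp hfc)
  have h : g.toLinearMap = Finsupp.linearCombination ℝ (cone ∘ f) := by
    refine Finsupp.lhom_ext' (M := ℝ) fun x => LinearMap.ext_ring ?_
    refine (hg x).trans ?_
    simp
  have hi : Function.Injective (Finsupp.linearCombination ℝ (cone ∘ f)) :=
    -- Linear independence is by definition injectivity of `Finsupp.linearCombination`.
    linearIndependent_cone.comp f hf
  rw [← h] at hi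
  exact .of_injective_continuous (f := g) hi g.continuous

/-- A continuous injection from a compact space to a Hausdorff one is an embedding. -/
theorem Submetrizable.firstCountableTopology_of_isCompact {X : Type*} [TopologicalSpace X]
    (h : Submetrizable X) {K : Set X} (hK : IsCompact K) : FirstCountableTopology K := by
  obtain ⟨Y, _, f, hf, hfc⟩ := h.exists_injective_continuous
  have : CompactSpace K := isCompact_iff_compactSpace.1 hK
  have he : IsClosedEmbedding fun x : K => f x :=
    (hfc.comp continuous_subtype_val).isClosedEmbedding (hf.comp Subtype.val_injective)
  exact he.isEmbedding.firstCountableTopology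

theorem Submetrizable.sequentialSpace {X : Type*} [TopologicalSpace X]
    [CompactlyCoherentSpace X] (h : Submetrizable X) : SequentialSpace X := by
  refine ⟨fun C hC => (CompactlyCoherentSpace.isClosed_iff C).2 fun K hK => ?_⟩
  have := h.firstCountableTopology_of_isCompact hK
  -- In the first-countable `K`, sequentially closed sets are closed.
  exact (hC.preimage continuous_subtype_val.seqContinuous).isClosed

theorem mainTheorem10 (X : Type*) [TopologicalSpace X] [T35Space X] (hX : Submetrizable X) :
    Submetrizable (FreeTVS X) ∧
      (CompactlyCoherentSpace (FreeTVS X) ↔ SequentialSpace (FreeTVS X)) :=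
  ⟨FreeTVS.submetrizable hX, fun _ => (FreeTVS.submetrizable hX).sequentialSpace,
    fun _ => inferInstance⟩
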